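/- Everything is of class $C^\infty$, and submanifolds are embedded. Let $(M,\Lambda,E)$ be a Jacobi manifold, i.e. a manifold $M$ with a bivector field $\Lambda$ and a vector field $E$ such that $\{f,g\}=\Lambda(df,dg)+f\,(Eg)-g\,(Ef)$ is a Lie algebra bracket on $C^\infty(M)$. Let $(N,\nu N)$ be a normalized submanifold of $M$, i.e. a submanifold $N$ with a smooth subbundle $\nu N\subseteq TM|_N$ such that $TM|_N=TN\oplus\nu N$. A vector field $X$ on $M$ is normal to $N$ if $X|_N\in\Gamma(\nu N)$. A bivector field $Q$ on $M$ is soldered to $(N,\nu N)$ if, along $N$, $\sharp_Q(\mathrm{ann}(\nu N))\subseteq TN$, where $\beta(\sharp_Q\alpha)=Q(\alpha,\beta)$, and $(L_XQ)|_{\mathrm{ann}(\nu N)}=0$ for every vector field $X$ on $M$ normal to $N$. A vector field $Y$ on $M$ is soldered to $(N,\nu N)$ if $Y|_N\in\Gamma(TN)$ and $[X,Y]|_N$ is annihilated by $\mathrm{ann}(\nu N)$ for every vector field $X$ on $M$ normal to $N$. The normalized submanifold $(N,\nu N)$ is called almost Dirac if $\Lambda$ is soldered to it, and Dirac if both $\Lambda$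 and $E$ are soldered to it. In natural coordinates $(z^i,\dot z^i)$ on $TM$, the complete lifts of $\Lambda=\frac12\Lambda^{ij}\frac{\partial}{\partial z^i}\wedge\frac{\partial}{\partial z^j}$ and $E=E^i\frac{\partial}{\partial z^i}$ are $$\Lambda^C=\Lambda^{ij}\frac{\partial}{\partial z^i}\wedge\frac{\partial}{\partial\dot z^j}+\frac12\,\dot z^k\frac{\partial\Lambda^{ij}}{\partial z^k}\frac{\partial}{\partial\dot z^i}\wedge\frac{\partial}{\partial\dot z^j},\qquad E^C=E^i\frac{\partial}{\partial z^i}+\dot z^k\frac{\partial E^i}{\partial z^k}\frac{\partial}{\partial\dot z^i}.$$ Regard $\nu N$ as a submanifold of $TM$, with tangent bundle $T\nu N\subseteq T(TM)|_{\nu N}$ and annihilator $\mathrm{ann}(T\nu N)\subseteq T^*(TM)|_{\nu N}$. Proposition. (1) $(N,\nu N)$ is almost Dirac if and only if $\sharp_{\Lambda^C}(\mathrm{ann}(T\nu N))\subseteq T\nu N$. (2) $(N,\nu N)$ is Dirac if and only if $\sharp_{\Lambda^C}(\mathrm{ann}(T\nu N))\subseteq T\nu N$ and, in addition, $E^C$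 is tangent to $\nu N$ along $\nu N$. -/

import Mathlib

open scoped Manifold ContDiff Topology

noncomputable section

namespace DiracSub

section Tensors

variable {V : Type*} [NormedAddCommGroup V] [NormedSpace ℝ V]
  {M : Type*} [TopologicalSpace M] [ChartedSpace V M]

/-- The cotangent space `T*_x M` of a manifold modelled on `V`. -/
abbrev Cotangent (V : Type*) [NormedAddCommGroup V] [NormedSpace ℝ V]
    {M : Type*} [TopologicalSpace M] [ChartedSpace V M] (x : M) : Type _ :=
  TangentSpace 𝓘(ℝ, V) x →L[ℝ] ℝ

/-- The differential `d f` of a real function, as a 1-form. -/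
def differential (V : Type*) [NormedAddCommGroup V] [NormedSpace ℝ V]
    {M : Type*} [TopologicalSpace M] [ChartedSpace V M] (f : M → ℝ) (x : M) : Cotangent V x :=
  ((NormedSpace.fromTangentSpace (𝕜 := ℝ) (f x)).toContinuousLinearMap) ∘L mfderiv 𝓘(ℝ, V) 𝓘(ℝ, ℝ) f x

/-- A (not necessarily smooth) vector field. -/
abbrev RoughVectorField (V : Type*) [NormedAddCommGroup V] [NormedSpace ℝ V]
    (M : Type*) [TopologicalSpace M] [ChartedSpace V M] : Type _ :=
  ∀ x : M, TangentSpace 𝓘(ℝ, V) x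

/-- Smoothness of a vector field on a set, as a section of the tangent bundle. -/
def SmoothVectorFieldOn [IsManifold 𝓘(ℝ, V) ∞ M] (X : RoughVectorField V M) (U : Set M) : Prop :=
  ContMDiffOn 𝓘(ℝ, V) 𝓘(ℝ, V).tangent ∞ (fun x => (⟨x, X x⟩ : TangentBundle 𝓘(ℝ, V) M)) U

/-- The derivative `X f` of a function along a vector field. -/
def applyField (X : RoughVectorField V M) (f : M → ℝ) (x : M) : ℝ :=
  differential V f x (X x)

/-- The representative of a vector field in the chart around `x₀`: its components
`(X^i)` as functions on the model space `V`. -/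
def vectorInChart (X : RoughVectorField V M) (x₀ : M) (z : V) : V :=
  let p := (extChartAt 𝓘(ℝ, V) x₀).symm z
  (mfderiv 𝓘(ℝ, V) 𝓘(ℝ, V) (extChartAt 𝓘(ℝ, V) x₀) p : TangentSpace 𝓘(ℝ, V) p →L[ℝ] V) (X p)

/-- A field of contravariant 2-tensors `Q`, encoded by the morphisms
`♯_Q : T*_x M → T_x M`, `β (♯_Q α) = Q (α, β)`. -/
abbrev RoughTensor (V : Type*) [NormedAddCommGroup V] [NormedSpace ℝ V]
    (M : Type*) [TopologicalSpace M] [ChartedSpace V M] : Type _ :=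
  ∀ x : M, Cotangent V x →L[ℝ] TangentSpace 𝓘(ℝ, V) x

/-- The representative of a contravariant 2-tensor field in the chart around `x₀`: its
components `(Q^{ij})`, as a function on `V` with values in the 2-tensors
`V* → V` on the model space. -/
def tensorInChart (Q : RoughTensor V M) (x₀ : M) (z : V) : (V →L[ℝ] ℝ) →L[ℝ] V :=
  let p := (extChartAt 𝓘(ℝ, V) x₀).symm z
  let A : TangentSpace 𝓘(ℝ, V) p →L[ℝ] V :=
    mfderiv 𝓘(ℝ, V) 𝓘(ℝ, V) (extChartAt 𝓘(ℝ, V) x₀) p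
  A ∘L Q p ∘L ContinuousLinearMap.precomp ℝ A

/-- A bivector field: a skew-symmetric contravariant 2-tensor field whose components in
the charts are smooth. -/
structure BivectorField (V : Type*) [NormedAddCommGroup V] [NormedSpace ℝ V]
    (M : Type*) [TopologicalSpace M] [ChartedSpace V M] where
  /-- the morphism `♯_Q : T*M → TM` -/
  sharp : RoughTensor V M
  skew : ∀ (x : M) (α β : Cotangent V x), β (sharp x α) = - α (sharp x β)
  smooth : ∀ x₀ : M,
    ContDiffOn ℝ ∞ (tensorInChart sharp x₀) (extChartAt 𝓘(ℝ, V) x₀).target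

/-- The value `Q (α, β)` of a bivector field on two covectors. -/
def BivectorField.eval (Q : BivectorField V M) {x : M} (α β : Cotangent V x) : ℝ :=
  β (Q.sharp x α)

/-- The function `Q (df, dg)`. -/
def BivectorField.onFunctions (Q : BivectorField V M) (f g : M → ℝ) (x : M) : ℝ :=
  Q.eval (differential V f x) (differential V g x)

/-- The Lie derivative `L_X Q` of a bivector field evaluated on the differentials of two
functions:
`(L_X Q)(df, dg) = X (Q (df, dg)) - Q (d (X f), dg) - Q (df, d (X g))`. -/
def BivectorField.lieDeriv (Q : BivectorField V M) (X : RoughVectorField V M)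
    (f g : M → ℝ) (x : M) : ℝ :=
  applyField X (Q.onFunctions f g) x
    - Q.onFunctions (applyField X f) g x - Q.onFunctions f (applyField X g) x

end Tensors

section Jacobi

/-- The bracket `{f, g} = Λ (df, dg) + f (E g) - g (E f)`. -/
def jacobiBracket {V : Type*} [NormedAddCommGroup V] [NormedSpace ℝ V]
    {M : Type*} [TopologicalSpace M] [ChartedSpace V M]
    (Λ : BivectorField V M) (E : RoughVectorField V M) (f g : M → ℝ) (x : M) : ℝ :=
  Λ.onFunctions f g x + f x * applyField E g x - g x * applyField E f x

/-- A Jacobi structure `(Λ, E)` on `M`: a bivector field and a vector field for which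
`{f, g} = Λ (df, dg) + f (E g) - g (E f)` is a Lie algebra bracket on `C^∞(M)`
(bilinearity and skew-symmetry are automatic). -/
structure JacobiStructure (V : Type*) [NormedAddCommGroup V] [NormedSpace ℝ V]
    (M : Type*) [TopologicalSpace M] [ChartedSpace V M] [IsManifold 𝓘(ℝ, V) ∞ M] where
  Λ : BivectorField V M
  E : RoughVectorField V M
  smooth_E : SmoothVectorFieldOn E Set.univ
  jacobi : ∀ f g h : M → ℝ, ContMDiff 𝓘(ℝ, V) 𝓘(ℝ, ℝ) ∞ f → ContMDiff 𝓘(ℝ, V) 𝓘(ℝ, ℝ) ∞ g →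
    ContMDiff 𝓘(ℝ, V) 𝓘(ℝ, ℝ) ∞ h → ∀ x,
    jacobiBracket Λ E f (jacobiBracket Λ E g h) x
      + jacobiBracket Λ E g (jacobiBracket Λ E h f) x
      + jacobiBracket Λ E h (jacobiBracket Λ E f g) x = 0

end Jacobi

section Submanifolds

/-- The tangent space at `p` of a subset `S` of a manifold (with model `I`), for use with
embedded submanifolds: the span of the velocities at `p` of the smooth curves in `S`
through `p`. For an embedded submanifold the velocities themselves are a linear subspace. -/
def tangentSpaceOf {F : Type*} [NormedAddCommGroup F] [NormedSpace ℝ F]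
    {H : Type*} [TopologicalSpace H] (I : ModelWithCorners ℝ F H)
    {P : Type*} [TopologicalSpace P] [ChartedSpace H P] (S : Set P) (p : P) :
    Submodule ℝ (TangentSpace I p) :=
  Submodule.span ℝ {v | ∃ γ : ℝ → P, ContMDiffAt 𝓘(ℝ, ℝ) I ∞ γ 0 ∧ (∀ᶠ t in 𝓝 0, γ t ∈ S) ∧
    tangentMap 𝓘(ℝ, ℝ) I γ ⟨0, (1 : ℝ)⟩ = (⟨p, v⟩ : TangentBundle I P)}

/-- The annihilator of a subspace of a tangent space. -/
def ann {F : Type*} [NormedAddCommGroup F] [NormedSpace ℝ F]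
    {H : Type*} [TopologicalSpace H] {I : ModelWithCorners ℝ F H}
    {P : Type*} [TopologicalSpace P] [ChartedSpace H P] {p : P}
    (W : Submodule ℝ (TangentSpace I p)) : Set (TangentSpace I p →L[ℝ] ℝ) :=
  {α | ∀ w ∈ W, α w = 0}

variable {V : Type*} [NormedAddCommGroup V] [NormedSpace ℝ V]
  {M : Type*} [TopologicalSpace M] [ChartedSpace V M]

/-- `N` is an embedded submanifold of `M` of dimension `n`: around each of its points there
is a chart of the smooth structure of `M` in which `N` is an `n`-dimensional linear slice. -/
def IsEmbeddedSubmanifold (V : Type*) [NormedAddCommGroup V] [NormedSpace ℝ V]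
    {M : Type*} [TopologicalSpace M] [ChartedSpace V M] (n : ℕ) (N : Set M) : Prop :=
  ∀ p ∈ N, ∃ φ ∈ IsManifold.maximalAtlas 𝓘(ℝ, V) ∞ M, p ∈ φ.source ∧
    ∃ S : Submodule ℝ V, Module.finrank ℝ S = n ∧ ∀ q ∈ φ.source, q ∈ N ↔ φ q ∈ S

/-- A field of subspaces of the tangent spaces. Only its values along a submanifold
`N` will matter. -/
abbrev SubspaceField (V : Type*) [NormedAddCommGroup V] [NormedSpace ℝ V]
    (M : Type*) [TopologicalSpace M] [ChartedSpace V M] : Type _ :=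
  ∀ x : M, Submodule ℝ (TangentSpace 𝓘(ℝ, V) x)

/-- `(N, ν)` is a normalized submanifold of `M`: `N` is an embedded submanifold, `ν` is a
smooth subbundle of `TM|_N` (it has smooth local frames) and `TM|_N = TN ⊕ ν`. -/
structure IsNormalizedSubmanifold [IsManifold 𝓘(ℝ, V) ∞ M] (n : ℕ) (N : Set M) (ν : SubspaceField V M) : Prop where
  embedded : IsEmbeddedSubmanifold V n N
  smooth_normal : ∀ x ∈ N, ∃ U : Set M, IsOpen U ∧ x ∈ U ∧
    ∃ (k : ℕ) (X : Fin k → RoughVectorField V M), (∀ i, SmoothVectorFieldOn (X i) U) ∧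
      ∀ y ∈ N ∩ U, LinearIndependent ℝ (fun i => X i y) ∧
        Submodule.span ℝ (Set.range fun i => X i y) = ν y
  splitting : ∀ x ∈ N, IsCompl (tangentSpaceOf 𝓘(ℝ, V) N x) (ν x)

/-- The total space `νN` of the normal bundle, as a subset of `TM`. -/
def normalTotalSpace (N : Set M) (ν : SubspaceField V M) : Set (TangentBundle 𝓘(ℝ, V) M) :=
  {v | v.proj ∈ N ∧ v.snd ∈ ν v.proj}

/-- `X` is a (smooth) vector field on `M` normal to `(N, ν)`. -/
def IsNormalField [IsManifold 𝓘(ℝ, V) ∞ M] (N : Set M) (ν : SubspaceField V M) (X : RoughVectorField V M) : Prop :=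
  SmoothVectorFieldOn X Set.univ ∧ ∀ x ∈ N, X x ∈ ν x

/-- The bivector field `Q` is soldered to `(N, ν)`:
i) `i(λ) Q = ♯_Q λ` is tangent to `N` along `N` for `λ ∈ ann ν`;
ii) `(L_X Q)|_{ann ν} = 0` along `N` for every vector field `X` normal to `N`. -/
structure IsSolderedBivector [IsManifold 𝓘(ℝ, V) ∞ M] (N : Set M) (ν : SubspaceField V M) (Q : BivectorField V M) :
    Prop where
  algebraic : ∀ x ∈ N, ∀ α ∈ ann (ν x), Q.sharp x α ∈ tangentSpaceOf 𝓘(ℝ, V) N x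
  lie : ∀ X : RoughVectorField V M, IsNormalField N ν X → ∀ x ∈ N, ∀ f g : M → ℝ,
    ContMDiff 𝓘(ℝ, V) 𝓘(ℝ, ℝ) ∞ f → ContMDiff 𝓘(ℝ, V) 𝓘(ℝ, ℝ) ∞ g →
    differential V f x ∈ ann (ν x) → differential V g x ∈ ann (ν x) → Q.lieDeriv X f g x = 0

/-- The vector field `Y` is soldered to `(N, ν)`: i) `Y` is tangent to `N` along `N`;
ii) `L_X Y = [X, Y]` vanishes on `ann ν` along `N` for every vector field `X` normal to `N`. -/
structure IsSolderedVector [IsManifold 𝓘(ℝ, V) ∞ M] (N : Set M) (ν : SubspaceField V M) (Y : RoughVectorField V M) :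
    Prop where
  algebraic : ∀ x ∈ N, Y x ∈ tangentSpaceOf 𝓘(ℝ, V) N x
  lie : ∀ X : RoughVectorField V M, IsNormalField N ν X → ∀ x ∈ N, ∀ α ∈ ann (ν x),
    α (VectorField.mlieBracket 𝓘(ℝ, V) X Y x) = 0

/-- `(N, ν)` is an almost Dirac submanifold of the Jacobi manifold `(M, Λ, E)`. -/
def IsAlmostDirac [IsManifold 𝓘(ℝ, V) ∞ M] (J : JacobiStructure V M) (N : Set M) (ν : SubspaceField V M) : Prop :=
  IsSolderedBivector N ν J.Λ

/-- `(N, ν)` is a Dirac submanifold of the Jacobi manifold `(M, Λ, E)`. -/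
def IsDirac [IsManifold 𝓘(ℝ, V) ∞ M] (J : JacobiStructure V M) (N : Set M) (ν : SubspaceField V M) : Prop :=
  IsSolderedBivector N ν J.Λ ∧ IsSolderedVector N ν J.E

end Submanifolds

section CompleteLift

variable {V : Type*} [NormedAddCommGroup V] [NormedSpace ℝ V]
  {M : Type*} [TopologicalSpace M] [ChartedSpace V M] [IsManifold 𝓘(ℝ, V) ∞ M]

/-- The natural coordinates `(z, ż)` of a tangent vector `v`, induced by the chart of `M`
around its base point. -/
def naturalCoord (v : TangentBundle 𝓘(ℝ, V) M) : V × V :=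
  (extChartAt 𝓘(ℝ, V) v.proj v.proj,
    (mfderiv 𝓘(ℝ, V) 𝓘(ℝ, V) (extChartAt 𝓘(ℝ, V) v.proj) v.proj :
      TangentSpace 𝓘(ℝ, V) v.proj →L[ℝ] V) v.snd)

/-- The coordinate frame of `TM` at `v`: the map sending `(a, b)` to
`a^i ∂/∂z^i + b^i ∂/∂ż^i ∈ T_v (TM)`. The chart `extChartAt` of `TM` around `v` gives the
natural coordinates induced by the chart of `M` around the base point of `v`. -/
def coordFrame (v : TangentBundle 𝓘(ℝ, V) M) :
    V × V →L[ℝ] TangentSpace 𝓘(ℝ, V).tangent v :=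
  (mfderiv 𝓘(ℝ, V).tangent 𝓘(ℝ, V × V) (extChartAt 𝓘(ℝ, V).tangent v) v :
    TangentSpace 𝓘(ℝ, V).tangent v →L[ℝ] V × V).inverse

/-- The complete lift `X^C = X^i ∂/∂z^i + ż^k (∂X^i/∂z^k) ∂/∂ż^i` of a vector field. -/
def completeLiftVector (X : RoughVectorField V M) (v : TangentBundle 𝓘(ℝ, V) M) :
    TangentSpace 𝓘(ℝ, V).tangent v :=
  let z := (naturalCoord v).1
  let z' := (naturalCoord v).2
  coordFrame v (vectorInChart X v.proj z, fderiv ℝ (vectorInChart X v.proj) z z')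

/-- The complete lift
`Q^C = Q^{ij} ∂/∂z^i ∧ ∂/∂ż^j + (1/2) ż^k (∂Q^{ij}/∂z^k) ∂/∂ż^i ∧ ∂/∂ż^j`
of a contravariant skew-symmetric 2-tensor field, encoded by the morphism
`♯_{Q^C} : T*_v(TM) → T_v(TM)`. If the covector has components `a` along the `dz^i` and `b`
along the `dż^i`, then its image is `♯_Q b` in the directions `∂/∂z^i` and
`♯_Q a + (ż^k ∂♯_Q/∂z^k) b` in the directions `∂/∂ż^i`. -/
def completeLiftTensor (Q : RoughTensor V M) (v : TangentBundle 𝓘(ℝ, V) M) :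
    (TangentSpace 𝓘(ℝ, V).tangent v →L[ℝ] ℝ) →L[ℝ] TangentSpace 𝓘(ℝ, V).tangent v :=
  let z := (naturalCoord v).1
  let z' := (naturalCoord v).2
  let a : (TangentSpace 𝓘(ℝ, V).tangent v →L[ℝ] ℝ) →L[ℝ] (V →L[ℝ] ℝ) :=
    ContinuousLinearMap.precomp ℝ (coordFrame v ∘L ContinuousLinearMap.inl ℝ V V)
  let b : (TangentSpace 𝓘(ℝ, V).tangent v →L[ℝ] ℝ) →L[ℝ] (V →L[ℝ] ℝ) :=
    ContinuousLinearMap.precomp ℝ (coordFrame v ∘L ContinuousLinearMap.inr ℝ V V)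
  coordFrame v ∘L
    ((tensorInChart Q v.proj z ∘L b).prod
      (tensorInChart Q v.proj z ∘L a + fderiv ℝ (tensorInChart Q v.proj) z z' ∘L b))

end CompleteLift

end DiracSub

end

open scoped Manifold ContDiff Topology

noncomputable section

namespace DiracSub

/-! ### Velocities of curves, computed in a chart. -/

section Velocities

variable {F : Type*} [NormedAddCommGroup F] [NormedSpace ℝ F]
  {H : Type*} [TopologicalSpace H] {I : ModelWithCorners ℝ F H}
  {P : Type*} [TopologicalSpace P] [ChartedSpace H P]

/-! Through every `v ∈ νN` passes a normal field `X` (`exists_isNormalField_eq`), and `X` describes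
`νN` to first order. In natural coordinates, with `D` the derivative at `x` of the components of
`X`, the tangent space of `νN` at `X x` consists of the pairs `(a, b)` with `a ∈ T_xN` and `b - D a
∈ ν_x` (`mem_tangentSpaceOf_normalTotalSpace_iff`). Both complete lifts are tested against this
subspace.

For a vector field, `Y^C` at `X x` is `(Y, DY(X))`, so tangency says `Y ∈ T_xN` and `DY(X) - D(Y) =
[X, Y] ∈ ν_x` (`mlieBracket_eq`), which is soldering.

For a bivector field with components `q` and derivative `q'` along `X`, the lift sends `(a, b)` to
`(q b, q a + q' b)`. A covector `(a, b)` annihilates the tangent space of `νN` exactly when `b`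
kills `ν_x` and `a + b ∘ D` kills `T_xN`. Tangency of the image first says `q b ∈ T_xN`. It also
says that every `c ∈ ann ν_x` kills `q a + q' b - D (q b)`. Here `a` may be replaced by `-b ∘ D`,
because `c (q (a + b ∘ D)) = -(a + b ∘ D) (q c) = 0` when `q c ∈ T_xN`. The result is the coordinate
expression of `(L_X Q)(b, c)` (`lift_mem_iff`, `lieDeriv_eq`). -/

theorem hasMFDerivAt_curve_iff {γ : ℝ → P} {v : TangentSpace I (γ 0)}
    (hγ : ContinuousAt γ 0) :
    HasMFDerivAt 𝓘(ℝ, ℝ) I γ 0 (ContinuousLinearMap.toSpanSingleton ℝ v) ↔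
      HasDerivAt (F := F) (fun t => extChartAt I (γ 0) (γ t)) v 0 := by
  unfold HasMFDerivAt
  simp only [hγ, true_and, writtenInExtChartAt, extChartAt, mfld_simps]
  exact hasFDerivWithinAt_univ

/-- Separates an equality in the total space into its base point and a derivative in the fixed model
space `F`, so that velocities become ordinary derivatives. -/
theorem exists_velocity_iff {S : Set P} {p : P} {v : TangentSpace I p} :
    (∃ γ : ℝ → P, ContMDiffAt 𝓘(ℝ, ℝ) I ∞ γ 0 ∧ (∀ᶠ t in 𝓝 0, γ t ∈ S) ∧
      tangentMap 𝓘(ℝ, ℝ) I γ ⟨0, (1 : ℝ)⟩ = (⟨p, v⟩ : TangentBundle I P)) ↔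
    ∃ γ : ℝ → P, ContMDiffAt 𝓘(ℝ, ℝ) I ∞ γ 0 ∧ (∀ᶠ t in 𝓝 0, γ t ∈ S) ∧ γ 0 = p ∧
      HasDerivAt (F := F) (fun t => extChartAt I p (γ t)) v 0 := by
  constructor
  · rintro ⟨γ, hγ, hS, h⟩
    refine ⟨γ, hγ, hS, congrArg Bundle.TotalSpace.proj h, ?_⟩
    have h0 : γ 0 = p := congrArg Bundle.TotalSpace.proj h
    subst h0
    have hv : mfderiv 𝓘(ℝ, ℝ) I γ 0 (1 : ℝ) = v := by
      have := h
      simp only [tangentMap] at this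
      exact eq_of_heq (Bundle.TotalSpace.mk.inj this).2
    rw [← hasMFDerivAt_curve_iff hγ.continuousAt]
    have h1 : ContinuousLinearMap.toSpanSingleton ℝ v = mfderiv 𝓘(ℝ, ℝ) I γ 0 := by
      refine ContinuousLinearMap.ext_ring ?_
      exact (one_smul ℝ v).trans hv.symm
    rw [h1]
    exact (hγ.mdifferentiableAt (by simp)).hasMFDerivAt
  · rintro ⟨γ, hγ, hS, rfl, h⟩
    refine ⟨γ, hγ, hS, ?_⟩
    rw [← hasMFDerivAt_curve_iff hγ.continuousAt] at h
    simp only [tangentMap, h.mfderiv]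
    congr 1
    exact one_smul ℝ v

theorem mem_tangentSpaceOf_of_hasDerivAt {S : Set P} {p : P} {v : TangentSpace I p} {γ : ℝ → P}
    (hγ : ContMDiffAt 𝓘(ℝ, ℝ) I ∞ γ 0) (hS : ∀ᶠ t in 𝓝 0, γ t ∈ S) (h0 : γ 0 = p)
    (h : HasDerivAt (F := F) (fun t => extChartAt I p (γ t)) v 0) :
    v ∈ tangentSpaceOf I S p :=
  Submodule.subset_span (exists_velocity_iff.2 ⟨γ, hγ, hS, h0, h⟩)

/-- Linear conditions on the tangent space need only be checked on velocities. -/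
theorem tangentSpaceOf_le {S : Set P} {p : P} {W : Submodule ℝ (TangentSpace I p)}
    (h : ∀ γ : ℝ → P, ContMDiffAt 𝓘(ℝ, ℝ) I ∞ γ 0 → (∀ᶠ t in 𝓝 0, γ t ∈ S) → γ 0 = p →
      ∀ v : F, HasDerivAt (fun t => extChartAt I p (γ t)) v 0 → v ∈ W) :
    tangentSpaceOf I S p ≤ W := by
  refine Submodule.span_le.2 fun v hv => ?_
  obtain ⟨γ, hγ, hS, h0, hd⟩ := exists_velocity_iff.1 hv
  exact h γ hγ hS h0 v hd

end Velocities

/-! ### Natural coordinates and the complete lifts in them. -/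

section Charts

variable {V : Type*} [NormedAddCommGroup V] [NormedSpace ℝ V]
  {M : Type*} [TopologicalSpace M] [ChartedSpace V M]

/-- The derivative at `y` of the chart around `x`. -/
def chartDeriv (V : Type*) [NormedAddCommGroup V] [NormedSpace ℝ V]
    {M : Type*} [TopologicalSpace M] [ChartedSpace V M] (x y : M) :
    TangentSpace 𝓘(ℝ, V) y →L[ℝ] V :=
  mfderiv 𝓘(ℝ, V) 𝓘(ℝ, V) (extChartAt 𝓘(ℝ, V) x) y

theorem vectorInChart_extChartAt (X : RoughVectorField V M) {x y : M}
    (hy : y ∈ (extChartAt 𝓘(ℝ, V) x).source) :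
    vectorInChart X x (extChartAt 𝓘(ℝ, V) x y) = chartDeriv V x y (X y) := by
  -- The point in `vectorInChart` is only propositionally `y`, and the tangent spaces depend on it,
  -- hence the generalization over `p`.
  have h : ∀ p, p = y → chartDeriv V x p (X p) = chartDeriv V x y (X y) := by
    rintro _ rfl; rfl
  exact h _ ((extChartAt 𝓘(ℝ, V) x).left_inv hy)

theorem tensorInChart_extChartAt (Q : RoughTensor V M) {x y : M}
    (hy : y ∈ (extChartAt 𝓘(ℝ, V) x).source) (β : V →L[ℝ] ℝ) :
    tensorInChart Q x (extChartAt 𝓘(ℝ, V) x y) β =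
      chartDeriv V x y (Q y (β ∘L chartDeriv V x y)) := by
  have h : ∀ p, p = y → chartDeriv V x p (Q p (β ∘L chartDeriv V x p)) =
      chartDeriv V x y (Q y (β ∘L chartDeriv V x y)) := by
    rintro _ rfl; rfl
  exact h _ ((extChartAt 𝓘(ℝ, V) x).left_inv hy)

variable [IsManifold 𝓘(ℝ, V) ∞ M]

theorem chartDeriv_self (x : M) (v : TangentSpace 𝓘(ℝ, V) x) : chartDeriv V x x v = v := by
  have : IsManifold 𝓘(ℝ, V) 1 M := .of_le (n := ∞) (by simp)
  unfold chartDeriv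
  rw [mfderiv_extChartAt_self]
  rfl

theorem trivializationAt_apply_eq_chartDeriv {x : M} {w : TangentBundle 𝓘(ℝ, V) M}
    (hw : w.proj ∈ (extChartAt 𝓘(ℝ, V) x).source) :
    trivializationAt V (TangentSpace 𝓘(ℝ, V)) x w = (w.proj, chartDeriv V x w.proj w.snd) := by
  have : IsManifold 𝓘(ℝ, V) 1 M := .of_le (n := ∞) (by simp)
  rw [extChartAt_source] at hw
  unfold chartDeriv
  rw [← TangentBundle.continuousLinearMapAt_trivializationAt hw,
    TangentBundle.continuousLinearMapAt_trivializationAt_eq_core hw]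
  rfl

theorem extChartAt_tangent_apply {v w : TangentBundle 𝓘(ℝ, V) M}
    (hw : w.proj ∈ (extChartAt 𝓘(ℝ, V) v.proj).source) :
    extChartAt 𝓘(ℝ, V).tangent v w =
      (extChartAt 𝓘(ℝ, V) v.proj w.proj, chartDeriv V v.proj w.proj w.snd) := by
  have h := congrArg Prod.snd (trivializationAt_apply_eq_chartDeriv hw)
  exact Prod.ext rfl h

/-- A tangent space is the model space read in the preferred chart at its point, and that chart has
identity derivative there. All lifts thus become plain pairs in `V × V`. -/
theorem coordFrame_apply (v : TangentBundle 𝓘(ℝ, V) M) (p : V × V) : coordFrame v p = p := by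
  have : IsManifold 𝓘(ℝ, V).tangent 1 (TangentBundle 𝓘(ℝ, V) M) := .of_le (n := ∞) (by simp)
  unfold coordFrame
  rw [mfderiv_extChartAt_self]
  exact congrArg (fun f : V × V →L[ℝ] V × V => f p) ContinuousLinearMap.inverse_id

theorem naturalCoord_eq (v : TangentBundle 𝓘(ℝ, V) M) :
    naturalCoord v = (extChartAt 𝓘(ℝ, V) v.proj v.proj, v.snd) :=
  Prod.ext rfl (chartDeriv_self v.proj v.snd)

theorem completeLiftVector_eq (X : RoughVectorField V M) (v : TangentBundle 𝓘(ℝ, V) M) :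
    completeLiftVector X v =
      ((X v.proj, fderiv ℝ (vectorInChart X v.proj) (extChartAt 𝓘(ℝ, V) v.proj v.proj) v.snd) :
        V × V) := by
  unfold completeLiftVector
  simp only [naturalCoord_eq]
  rw [coordFrame_apply, vectorInChart_extChartAt X (mem_extChartAt_source _), chartDeriv_self]

theorem tensorInChart_self (Q : RoughTensor V M) (x : M) (β : V →L[ℝ] ℝ) :
    tensorInChart Q x (extChartAt 𝓘(ℝ, V) x x) β = Q x β := by
  rw [tensorInChart_extChartAt Q (mem_extChartAt_source _), chartDeriv_self]
  congr 1
  ext w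
  exact congrArg β (chartDeriv_self x w)

theorem completeLiftTensor_eq (Q : RoughTensor V M) (v : TangentBundle 𝓘(ℝ, V) M)
    (a b : V →L[ℝ] ℝ) :
    completeLiftTensor Q v (a.coprod b : V × V →L[ℝ] ℝ) =
      ((tensorInChart Q v.proj (extChartAt 𝓘(ℝ, V) v.proj v.proj) b,
        tensorInChart Q v.proj (extChartAt 𝓘(ℝ, V) v.proj v.proj) a +
        fderiv ℝ (tensorInChart Q v.proj) (extChartAt 𝓘(ℝ, V) v.proj v.proj) v.snd b) :
        V × V) := by
  have ha : (ContinuousLinearMap.precomp ℝ (coordFrame v ∘L ContinuousLinearMap.inl ℝ V V))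
      (a.coprod b : V × V →L[ℝ] ℝ) = a := by
    ext w
    refine (congrArg (a.coprod b) (coordFrame_apply v (w, 0))).trans ?_
    simp
  have hb : (ContinuousLinearMap.precomp ℝ (coordFrame v ∘L ContinuousLinearMap.inr ℝ V V))
      (a.coprod b : V × V →L[ℝ] ℝ) = b := by
    ext w
    refine (congrArg (a.coprod b) (coordFrame_apply v (0, w))).trans ?_
    simp
  refine (coordFrame_apply v _).trans ?_
  have hz' : (naturalCoord v).2 = v.snd := chartDeriv_self v.proj v.snd
  refine Prod.ext ?_ ?_
  · exact congrArg (tensorInChart Q v.proj _) hb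
  · refine congrArg₂ (· + ·) (congrArg (tensorInChart Q v.proj _) ha) ?_
    refine (congrArg _ hb).trans ?_
    exact congrArg (fun w => fderiv ℝ (tensorInChart Q v.proj) _ w b) hz'

end Charts

/-! ### The tangent space of the total space of the normal bundle. -/

section NormalBundle

variable {V : Type*} [NormedAddCommGroup V] [NormedSpace ℝ V]
  {M : Type*} [TopologicalSpace M] [ChartedSpace V M] [IsManifold 𝓘(ℝ, V) ∞ M]
  {N : Set M} {ν : SubspaceField V M} {X : RoughVectorField V M} {x : M}

theorem contMDiffAt_chartDeriv
    (hX : ContMDiffAt 𝓘(ℝ, V) 𝓘(ℝ, V).tangent ∞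
      (fun y => (⟨y, X y⟩ : TangentBundle 𝓘(ℝ, V) M)) x) :
    ContMDiffAt 𝓘(ℝ, V) 𝓘(ℝ, V) ∞ (fun y => chartDeriv V x y (X y)) x := by
  refine (Bundle.contMDiffAt_totalSpace.1 hX).2.congr_of_eventuallyEq ?_
  filter_upwards [extChartAt_source_mem_nhds (I := 𝓘(ℝ, V)) x] with y hy
  exact (congrArg Prod.snd
    (trivializationAt_apply_eq_chartDeriv (w := (⟨y, X y⟩ : TangentBundle 𝓘(ℝ, V) M)) hy)).symm

theorem contDiffAt_vectorInChart
    (hX : ContMDiffAt 𝓘(ℝ, V) 𝓘(ℝ, V).tangent ∞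
      (fun y => (⟨y, X y⟩ : TangentBundle 𝓘(ℝ, V) M)) x) :
    ContDiffAt ℝ ∞ (vectorInChart X x) (extChartAt 𝓘(ℝ, V) x x) := by
  rw [← contMDiffAt_iff_contDiffAt]
  have h1 := contMDiffAt_chartDeriv hX
  have h2 : ContMDiffAt 𝓘(ℝ, V) 𝓘(ℝ, V) ∞ (extChartAt 𝓘(ℝ, V) x).symm
      (extChartAt 𝓘(ℝ, V) x x) :=
    (contMDiffOn_extChartAt_symm x).contMDiffAt (extChartAt_target_mem_nhds x)
  exact ContMDiffAt.comp_of_eq (g := fun y => chartDeriv V x y (X y)) h1 h2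
    (extChartAt_to_inv (I := 𝓘(ℝ, V)) x)

/-- A subbundle is closed over `N`. If the limit left `ν x`, it would be linearly independent of a
local frame at `x`; independence is an open condition, so it would persist nearby, where the vectors
lie in the span of the frame. -/
theorem mem_of_tendsto_chartDeriv [FiniteDimensional ℝ V] {n : ℕ}
    (hN : IsNormalizedSubmanifold n N ν) (hx : x ∈ N)
    {ι : Type*} {l : Filter ι} [l.NeBot] {w : ι → TangentBundle 𝓘(ℝ, V) M}
    (hw : ∀ᶠ t in l, w t ∈ normalTotalSpace N ν)
    (hc : Filter.Tendsto (fun t => (w t).proj) l (𝓝 x)) {L : V}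
    (hL : Filter.Tendsto (fun t => chartDeriv V x (w t).proj (w t).snd) l (𝓝 L)) :
    L ∈ ν x := by
  obtain ⟨U, hU, hxU, k, Y, hY, hν⟩ := hN.smooth_normal x hx
  obtain ⟨hli, hspan⟩ := hν x ⟨hx, hxU⟩
  rw [← hspan]
  by_contra hLn
  have hlim : LinearIndependent ℝ (Fin.cons L (fun i => chartDeriv V x x (Y i x)) :
      Fin (k + 1) → V) := by
    simp only [chartDeriv_self]
    exact linearIndependent_finCons.2 ⟨hli, hLn⟩
  have htend : Filter.Tendsto (fun t => (Fin.cons (chartDeriv V x (w t).proj (w t).snd)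
      (fun i => chartDeriv V x (w t).proj (Y i (w t).proj)) : Fin (k + 1) → V)) l
      (𝓝 (Fin.cons L (fun i => chartDeriv V x x (Y i x)))) := by
    refine tendsto_pi_nhds.2 (Fin.cases ?_ fun i => ?_)
    · simpa using hL
    · simp only [Fin.cons_succ]
      exact (contMDiffAt_chartDeriv
        ((hY i).contMDiffAt (hU.mem_nhds hxU))).continuousAt.tendsto.comp hc
  have hev := htend.eventually (isOpen_setOfPred_linearIndependent.mem_nhds hlim)
  obtain ⟨t, ht, ht', htU⟩ :=
    (hev.and (hw.and (hc.eventually (hU.mem_nhds hxU)))).exists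
  have hmem := ht'.2
  rw [← (hν (w t).proj ⟨ht'.1, htU⟩).2] at hmem
  refine (linearIndependent_finCons.1 ht).2 ?_
  have := Submodule.mem_map_of_mem
    (f := (chartDeriv V x (w t).proj : TangentSpace 𝓘(ℝ, V) (w t).proj →ₗ[ℝ] V)) hmem
  rwa [Submodule.map_span, ← Set.range_comp] at this

/-- The tangent space of the total space of the normal bundle, in terms of a normal field. -/
theorem mem_tangentSpaceOf_normalTotalSpace_iff [FiniteDimensional ℝ V] {n : ℕ}
    (hN : IsNormalizedSubmanifold n N ν) (hX : IsNormalField N ν X) (hx : x ∈ N) (a b : V) :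
    ((a, b) : V × V) ∈ tangentSpaceOf 𝓘(ℝ, V).tangent (normalTotalSpace N ν) ⟨x, X x⟩ ↔
      a ∈ tangentSpaceOf 𝓘(ℝ, V) N x ∧
        b - fderiv ℝ (vectorInChart X x) (extChartAt 𝓘(ℝ, V) x x) a ∈ ν x := by
  have hXx : ContMDiffAt 𝓘(ℝ, V) 𝓘(ℝ, V).tangent ∞
      (fun y => (⟨y, X y⟩ : TangentBundle 𝓘(ℝ, V) M)) x := hX.1.contMDiffAt Filter.univ_mem
  have hXd := ((contDiffAt_vectorInChart hXx).differentiableAt (by simp)).hasFDerivAt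
  set D : V →L[ℝ] V := fderiv ℝ (vectorInChart X x) (extChartAt 𝓘(ℝ, V) x x)
  set S := tangentSpaceOf 𝓘(ℝ, V).tangent (normalTotalSpace N ν)
    (⟨x, X x⟩ : TangentBundle 𝓘(ℝ, V) M)
  let T : Submodule ℝ V := tangentSpaceOf 𝓘(ℝ, V) N x
  let ν₀ : Submodule ℝ V := ν x
  let S₀ : Submodule ℝ (V × V) := S
  constructor
  · let W : Submodule ℝ (V × V) := T.comap (LinearMap.fst ℝ V V) ⊓
      ν₀.comap (LinearMap.snd ℝ V V - (D : V →ₗ[ℝ] V) ∘ₗ LinearMap.fst ℝ V V)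
    suffices h : S₀ ≤ W from fun hab => h hab
    refine tangentSpaceOf_le fun γ hγ hmem h0 p hp => ?_
    have hcm : ContMDiffAt 𝓘(ℝ, ℝ) 𝓘(ℝ, V) ∞ (fun t => (γ t).proj) 0 :=
      (Bundle.contMDiffAt_totalSpace.1 hγ).1
    have hc0 : (γ 0).proj = x := by rw [h0]
    have hct : Filter.Tendsto (fun t => (γ t).proj) (𝓝 0) (𝓝 x) := by
      have := hcm.continuousAt.tendsto
      rwa [hc0] at this
    have hsrc := hct.eventually (extChartAt_source_mem_nhds (I := 𝓘(ℝ, V)) x)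
    have hp' : HasDerivAt (fun t => (extChartAt 𝓘(ℝ, V) x (γ t).proj,
        chartDeriv V x (γ t).proj (γ t).snd)) p 0 := by
      refine hp.congr_of_eventuallyEq ?_
      filter_upwards [hsrc] with t ht
      exact (extChartAt_tangent_apply (v := ⟨x, X x⟩) ht).symm
    have h1 : HasDerivAt (fun t => extChartAt 𝓘(ℝ, V) x (γ t).proj) p.1 0 :=
      (ContinuousLinearMap.fst ℝ V V).hasFDerivAt.comp_hasDerivAt (0 : ℝ) hp'
    have h2 : HasDerivAt (fun t => chartDeriv V x (γ t).proj (γ t).snd) p.2 0 :=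
      (ContinuousLinearMap.snd ℝ V V).hasFDerivAt.comp_hasDerivAt (0 : ℝ) hp'
    have h3 : HasDerivAt (fun t => vectorInChart X x (extChartAt 𝓘(ℝ, V) x (γ t).proj))
        (D p.1) 0 := by
      refine HasFDerivAt.comp_hasDerivAt (l := vectorInChart X x) (l' := D) (0 : ℝ) ?_ h1
      rwa [hc0]
    refine ⟨mem_tangentSpaceOf_of_hasDerivAt hcm (hmem.mono fun t ht => ht.1) hc0 h1, ?_⟩
    -- The curve `γ` and the field `X` along its projection agree at `t = 0` and both take values in
    -- `ν`. The difference quotients of their difference therefore lie in `ν`, and so does the limit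
    -- `p.2 - D p.1`.
    have h4 := (hasDerivAt_iff_tendsto_slope_zero.1 (h2.sub h3))
    refine mem_of_tendsto_chartDeriv hN hx (l := 𝓝[≠] (0 : ℝ))
      (w := fun t => ⟨(γ t).proj, t⁻¹ • ((γ t).snd - X (γ t).proj)⟩) ?_
      (hct.mono_left nhdsWithin_le_nhds) (L := p.2 - D p.1) (h4.congr' ?_)
    · filter_upwards [nhdsWithin_le_nhds hmem] with t ht
      exact ⟨ht.1, Submodule.smul_mem _ _ (Submodule.sub_mem _ ht.2 (hX.2 _ ht.1))⟩
    · filter_upwards [nhdsWithin_le_nhds hsrc] with t ht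
      have e0 : chartDeriv V x (γ 0).proj (γ 0).snd =
          vectorInChart X x (extChartAt 𝓘(ℝ, V) x (γ 0).proj) := by
        rw [h0, vectorInChart_extChartAt X (mem_extChartAt_source _)]
      simp only [zero_add, Pi.sub_apply, e0, sub_self, sub_zero]
      rw [vectorInChart_extChartAt X ht, map_smul, map_sub]
  · rintro ⟨ha, hb⟩
    -- Directions along `N`: a curve in `N` is lifted to `νN` by `X`.
    have key1 : T ≤ S₀.comap (LinearMap.id.prod (D : V →ₗ[ℝ] V)) := by
      refine tangentSpaceOf_le fun c hc hmem h0 p hp => ?_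
      have hcx : Filter.Tendsto c (𝓝 0) (𝓝 x) := h0 ▸ hc.continuousAt.tendsto
      refine mem_tangentSpaceOf_of_hasDerivAt
        (γ := fun t => (⟨c t, X (c t)⟩ : TangentBundle 𝓘(ℝ, V) M)) ?_ ?_ ?_ ?_
      · exact ContMDiffAt.comp (0 : ℝ) (h0.symm ▸ hXx) hc
      · filter_upwards [hmem] with t ht using ⟨ht, hX.2 _ ht⟩
      · rw [h0]
      · have h3 : HasDerivAt (fun t => vectorInChart X x (extChartAt 𝓘(ℝ, V) x (c t)))
            (D p) 0 := by
          refine HasFDerivAt.comp_hasDerivAt (l := vectorInChart X x) (l' := D) (0 : ℝ) ?_ hp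
          rwa [h0]
        refine (hp.prodMk h3).congr_of_eventuallyEq ?_
        filter_upwards [hcx.eventually (extChartAt_source_mem_nhds (I := 𝓘(ℝ, V)) x)] with t ht
        rw [vectorInChart_extChartAt X ht]
        exact extChartAt_tangent_apply (v := ⟨x, X x⟩)
          (w := (⟨c t, X (c t)⟩ : TangentBundle 𝓘(ℝ, V) M)) ht
    -- Vertical directions: a straight line in the fibre `ν x` through `X x`.
    have key2 (w : TangentSpace 𝓘(ℝ, V) x) (hw : w ∈ ν x) : ((0, w) : V × V) ∈ S₀ := by
      let γ : ℝ → TangentBundle 𝓘(ℝ, V) M := fun t => ⟨x, X x + t • w⟩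
      have hline (u v : V) : HasDerivAt (fun t : ℝ => u + t • v) v 0 := by
        simpa using ((hasDerivAt_id (0 : ℝ)).smul_const v).const_add u
      have hsmooth (u v : V) : ContDiffAt ℝ ∞ (fun t : ℝ => u + t • v) 0 :=
        contDiffAt_const.add (contDiffAt_id.smul contDiffAt_const)
      have hchart (t : ℝ) : chartDeriv V x (γ t).proj (γ t).snd = X x + t • w :=
        chartDeriv_self x _
      refine mem_tangentSpaceOf_of_hasDerivAt (γ := γ) ?_ ?_ ?_ ?_
      · refine Bundle.contMDiffAt_totalSpace.2 ⟨contMDiffAt_const, ?_⟩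
        refine (hsmooth (X x) w).contMDiffAt.congr_of_eventuallyEq
          (Filter.Eventually.of_forall fun t => ?_)
        exact (congrArg Prod.snd (trivializationAt_apply_eq_chartDeriv
          (w := γ t) (mem_extChartAt_source x))).trans (hchart t)
      · exact Filter.Eventually.of_forall fun t =>
          ⟨hx, Submodule.add_mem _ (hX.2 x hx) (Submodule.smul_mem _ _ hw)⟩
      · simp [γ]
      · refine ((hasDerivAt_const (0 : ℝ) (extChartAt 𝓘(ℝ, V) x x)).prodMk
          (hline (X x) w)).congr_of_eventuallyEq (Filter.Eventually.of_forall fun t => ?_)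
        refine (extChartAt_tangent_apply (v := ⟨x, X x⟩) (w := γ t)
          (mem_extChartAt_source x)).trans ?_
        rw [hchart]
        rfl
    have := S₀.add_mem (key1 ha) (key2 _ hb)
    have hab : ((LinearMap.id.prod (D : V →ₗ[ℝ] V)) a : V × V) + (0, b - D a) = (a, b) := by
      simp
    exact hab ▸ this

end NormalBundle

/-! ### Lie derivatives and Lie brackets in a chart. -/

section LieDerivatives

variable {V : Type*} [NormedAddCommGroup V] [NormedSpace ℝ V]
  {M : Type*} [TopologicalSpace M] [ChartedSpace V M] [IsManifold 𝓘(ℝ, V) ∞ M]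
  {N : Set M} {ν : SubspaceField V M} {x : M}

theorem differential_eq_of_hasFDerivAt {f : M → ℝ} {x y : M} {D : V →L[ℝ] ℝ}
    (hy : y ∈ (extChartAt 𝓘(ℝ, V) x).source)
    (h : HasFDerivAt (f ∘ (extChartAt 𝓘(ℝ, V) x).symm) D (extChartAt 𝓘(ℝ, V) x y)) :
    differential V f y = D ∘L chartDeriv V x y := by
  have : IsManifold 𝓘(ℝ, V) 1 M := .of_le (n := ∞) (by simp)
  have hy' := hy
  rw [extChartAt_source] at hy'
  have h1 : HasMFDerivAt 𝓘(ℝ, V) 𝓘(ℝ, V) (extChartAt 𝓘(ℝ, V) x) y (chartDeriv V x y) :=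
    (mdifferentiableAt_extChartAt hy').hasMFDerivAt
  have h2 := (h.hasMFDerivAt.comp y h1).congr_of_eventuallyEq (f₁ := f) (by
    filter_upwards [(isOpen_extChartAt_source (I := 𝓘(ℝ, V)) x).mem_nhds hy] with p hp
    rw [Function.comp_apply, Function.comp_apply, (extChartAt 𝓘(ℝ, V) x).left_inv hp])
  unfold differential
  rw [h2.mfderiv]
  rfl

theorem differential_self_of_hasFDerivAt {f : M → ℝ} {D : V →L[ℝ] ℝ}
    (h : HasFDerivAt (f ∘ (extChartAt 𝓘(ℝ, V) x).symm) D (extChartAt 𝓘(ℝ, V) x x)) :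
    differential V f x = D := by
  rw [differential_eq_of_hasFDerivAt (mem_extChartAt_source x) h]
  ext w
  exact congrArg D (chartDeriv_self x w)

theorem contDiffOn_comp_extChartAt_symm {f : M → ℝ} (hf : ContMDiff 𝓘(ℝ, V) 𝓘(ℝ, ℝ) ∞ f) (x : M) :
    ContDiffOn ℝ ∞ (f ∘ (extChartAt 𝓘(ℝ, V) x).symm) (extChartAt 𝓘(ℝ, V) x).target :=
  (hf.comp_contMDiffOn (contMDiffOn_extChartAt_symm x)).contDiffOn

theorem differential_eq {f : M → ℝ} (hf : ContMDiff 𝓘(ℝ, V) 𝓘(ℝ, ℝ) ∞ f) {z : V}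
    (hz : z ∈ (extChartAt 𝓘(ℝ, V) x).target) :
    differential V f ((extChartAt 𝓘(ℝ, V) x).symm z) =
      fderiv ℝ (f ∘ (extChartAt 𝓘(ℝ, V) x).symm) z ∘L
        chartDeriv V x ((extChartAt 𝓘(ℝ, V) x).symm z) := by
  refine differential_eq_of_hasFDerivAt ((extChartAt 𝓘(ℝ, V) x).map_target hz) ?_
  rw [(extChartAt 𝓘(ℝ, V) x).right_inv hz]
  exact (((contDiffOn_comp_extChartAt_symm hf x).contDiffAt
    ((isOpen_extChartAt_target x).mem_nhds hz)).differentiableAt (by simp)).hasFDerivAt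

/-- The Lie derivative of a bivector field in the coordinates of a chart. -/
theorem lieDeriv_eq (Q : BivectorField V M) {X : RoughVectorField V M}
    (hX : SmoothVectorFieldOn X Set.univ) {f g : M → ℝ}
    (hf : ContMDiff 𝓘(ℝ, V) 𝓘(ℝ, ℝ) ∞ f) (hg : ContMDiff 𝓘(ℝ, V) 𝓘(ℝ, ℝ) ∞ g)
    {α β : V →L[ℝ] ℝ} (hα : differential V f x = α) (hβ : differential V g x = β) :
    Q.lieDeriv X f g x =
      β (fderiv ℝ (tensorInChart Q.sharp x) (extChartAt 𝓘(ℝ, V) x x) (X x) α)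
      - β (tensorInChart Q.sharp x (extChartAt 𝓘(ℝ, V) x x)
          (α ∘L fderiv ℝ (vectorInChart X x) (extChartAt 𝓘(ℝ, V) x x)))
      - β (fderiv ℝ (vectorInChart X x) (extChartAt 𝓘(ℝ, V) x x)
          (tensorInChart Q.sharp x (extChartAt 𝓘(ℝ, V) x x) α)) := by
  set z₀ := extChartAt 𝓘(ℝ, V) x x with hz₀
  set F := f ∘ (extChartAt 𝓘(ℝ, V) x).symm
  set G := g ∘ (extChartAt 𝓘(ℝ, V) x).symm
  set q := tensorInChart Q.sharp x
  set ξ := vectorInChart X x with hξ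
  have hT := extChartAt_target_mem_nhds (I := 𝓘(ℝ, V)) x
  have cF : ContDiffAt ℝ ∞ F z₀ := (contDiffOn_comp_extChartAt_symm hf x).contDiffAt hT
  have cG : ContDiffAt ℝ ∞ G z₀ := (contDiffOn_comp_extChartAt_symm hg x).contDiffAt hT
  have dF := ((cF.fderiv_right (m := ∞) le_rfl).differentiableAt (by simp)).hasFDerivAt
  have dG := ((cG.fderiv_right (m := ∞) le_rfl).differentiableAt (by simp)).hasFDerivAt
  have dq := (((Q.smooth x).contDiffAt hT).differentiableAt (by simp)).hasFDerivAt
  have cξ : ContDiffAt ℝ ∞ ξ z₀ := contDiffAt_vectorInChart (hX.contMDiffAt Filter.univ_mem)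
  have dξ := (cξ.differentiableAt (by simp)).hasFDerivAt
  have h2 : minSmoothness ℝ 2 ≤ ∞ := by
    rw [minSmoothness_of_isRCLikeNormedField]; exact WithTop.coe_le_coe.2 (le_top (a := (2 : ℕ∞)))
  have sF : IsSymmSndFDerivAt ℝ F z₀ := cF.isSymmSndFDerivAt h2
  have sG : IsSymmSndFDerivAt ℝ G z₀ := cG.isSymmSndFDerivAt h2
  have eα : fderiv ℝ F z₀ = α :=
    (differential_self_of_hasFDerivAt (cF.differentiableAt (by simp)).hasFDerivAt).symm.trans hα
  have eβ : fderiv ℝ G z₀ = β :=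
    (differential_self_of_hasFDerivAt (cG.differentiableAt (by simp)).hasFDerivAt).symm.trans hβ
  have hξ₀ : ξ z₀ = X x := by
    rw [hξ, hz₀, vectorInChart_extChartAt X (mem_extChartAt_source x), chartDeriv_self]
  have hQfg : Q.onFunctions f g ∘ (extChartAt 𝓘(ℝ, V) x).symm =ᶠ[𝓝 z₀]
      fun z => fderiv ℝ G z (q z (fderiv ℝ F z)) := by
    filter_upwards [hT] with z hz
    simp only [Function.comp_apply, BivectorField.onFunctions, BivectorField.eval,
      differential_eq hf hz, differential_eq hg hz]
    rfl
  have hXh {h : M → ℝ} (hh : ContMDiff 𝓘(ℝ, V) 𝓘(ℝ, ℝ) ∞ h) :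
      applyField X h ∘ (extChartAt 𝓘(ℝ, V) x).symm =ᶠ[𝓝 z₀]
      fun z => fderiv ℝ (h ∘ (extChartAt 𝓘(ℝ, V) x).symm) z (ξ z) := by
    filter_upwards [hT] with z hz
    simp only [Function.comp_apply, applyField, differential_eq hh hz]
    rfl
  have d1 := differential_self_of_hasFDerivAt
    ((dG.clm_apply (dq.clm_apply dF)).congr_of_eventuallyEq hQfg)
  have d2 := differential_self_of_hasFDerivAt ((dF.clm_apply dξ).congr_of_eventuallyEq (hXh hf))
  have d3 := differential_self_of_hasFDerivAt ((dG.clm_apply dξ).congr_of_eventuallyEq (hXh hg))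
  -- Symmetry of second derivatives makes the Hessian terms of `X (Q (df, dg))` cancel those of `Q
  -- (d (X f), dg)` and `Q (df, d (X g))`.
  have sF' : (fderiv ℝ (fderiv ℝ F) z₀).flip (ξ z₀) = fderiv ℝ (fderiv ℝ F) z₀ (ξ z₀) := by
    ext w; exact sF w (ξ z₀)
  have sG' : (fderiv ℝ (fderiv ℝ G) z₀).flip (ξ z₀) = fderiv ℝ (fderiv ℝ G) z₀ (ξ z₀) := by
    ext w; exact sG w (ξ z₀)
  have hsharp (γ : V →L[ℝ] ℝ) : Q.sharp x γ = q z₀ γ := (tensorInChart_self Q.sharp x γ).symm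
  unfold BivectorField.lieDeriv
  simp only [applyField, BivectorField.onFunctions, BivectorField.eval] at d1 d2 d3 ⊢
  rw [d1, d2, d3, hα, hβ, eα, eβ, sF', sG']
  rw [hsharp α]
  erw [hsharp]
  rw [← hξ₀]
  change β (q z₀ (fderiv ℝ (fderiv ℝ F) z₀ (ξ z₀)) + fderiv ℝ q z₀ (ξ z₀) α)
      + fderiv ℝ (fderiv ℝ G) z₀ (ξ z₀) (q z₀ α)
      - β (q z₀ (α ∘L fderiv ℝ ξ z₀ + fderiv ℝ (fderiv ℝ F) z₀ (ξ z₀)))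
      - (β (fderiv ℝ ξ z₀ (q z₀ α)) + fderiv ℝ (fderiv ℝ G) z₀ (ξ z₀) (q z₀ α)) = _
  rw [map_add, map_add, map_add]
  ring

/-- The manifold bracket is the bracket of the pullbacks by the inverse chart. Near the centre these
are the chart components, since the derivatives of the chart and of its inverse are mutually
inverse; at the centre the chart has identity derivative. -/
theorem mlieBracket_eq {X Y : RoughVectorField V M} :
    VectorField.mlieBracket 𝓘(ℝ, V) X Y x =
      ((fderiv ℝ (vectorInChart Y x) (extChartAt 𝓘(ℝ, V) x x) (X x) -
        fderiv ℝ (vectorInChart X x) (extChartAt 𝓘(ℝ, V) x x) (Y x) : V)) := by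
  have : IsManifold 𝓘(ℝ, V) 1 M := .of_le (n := ∞) (by simp)
  have key (Z : RoughVectorField V M) :
      VectorField.mpullbackWithin 𝓘(ℝ, V) 𝓘(ℝ, V) (extChartAt 𝓘(ℝ, V) x).symm Z
        (Set.range 𝓘(ℝ, V)) =ᶠ[𝓝 (extChartAt 𝓘(ℝ, V) x x)] vectorInChart Z x := by
    filter_upwards [extChartAt_target_mem_nhds (I := 𝓘(ℝ, V)) x] with z hz
    rw [VectorField.mpullbackWithin_apply, ContinuousLinearMap.inverse_eq
      (mfderivWithin_extChartAt_symm_comp_mfderiv_extChartAt hz)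
      (mfderiv_extChartAt_comp_mfderivWithin_extChartAt_symm hz)]
    rfl
  rw [← VectorField.mlieBracketWithin_univ, VectorField.mlieBracketWithin_apply,
    mfderiv_extChartAt_self]
  refine (congrArg (fun f : V →L[ℝ] V => f _) ContinuousLinearMap.inverse_id).trans ?_
  simp only [ModelWithCorners.range_eq_univ] at key
  rw [Set.preimage_univ, Set.univ_inter, ModelWithCorners.range_eq_univ]
  refine (congrFun (VectorField.lieBracketWithin_univ (𝕜 := ℝ) (E := V)) _).trans ?_
  refine (Filter.EventuallyEq.lieBracket_vectorField_eq (𝕜 := ℝ) (E := V) (key X) (key Y)).trans ?_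
  rw [VectorField.lieBracket_eq]
  simp only [vectorInChart_extChartAt _ (mem_extChartAt_source x), chartDeriv_self]

end LieDerivatives

/-! ### Global normal fields and functions with prescribed values at a point. -/

section Extensions

variable {V : Type*} [NormedAddCommGroup V] [NormedSpace ℝ V] [FiniteDimensional ℝ V]
  {M : Type*} [TopologicalSpace M] [T2Space M] [ChartedSpace V M] [IsManifold 𝓘(ℝ, V) ∞ M]
  {N : Set M} {ν : SubspaceField V M} {x : M}

/-- A constant-coefficient combination of a local frame, cut off by a bump function supported in the
domain of the frame, stays in `ν` along all of `N`. -/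
theorem exists_isNormalField_eq {n : ℕ} (hN : IsNormalizedSubmanifold n N ν) (hx : x ∈ N)
    {v : TangentSpace 𝓘(ℝ, V) x} (hv : v ∈ ν x) :
    ∃ X : RoughVectorField V M, IsNormalField N ν X ∧ X x = v := by
  obtain ⟨U, hU, hxU, k, Y, hY, hν⟩ := hN.smooth_normal x hx
  rw [← (hν x ⟨hx, hxU⟩).2, Submodule.mem_span_range_iff_exists_fun] at hv
  obtain ⟨c, rfl⟩ := hv
  obtain ⟨ρ, -, hρ⟩ :=
    (SmoothBumpFunction.nhds_basis_tsupport (I := 𝓘(ℝ, V)) x).mem_iff.1 (hU.mem_nhds hxU)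
  let Z : RoughVectorField V M := fun y => ∑ i, c i • Y i y
  have hZ : SmoothVectorFieldOn Z U :=
    ContMDiffOn.sum_section fun i _ => (hY i).const_smul_section (a := c i)
  refine ⟨fun y => ρ y • Z y, ⟨?_, fun y hy => ?_⟩, ?_⟩
  · exact (ContMDiffOn.smul_section_of_tsupport ρ.contMDiff.contMDiffOn hU hρ hZ).contMDiffOn
  · by_cases hyU : y ∈ U
    · rw [← (hν y ⟨hy, hyU⟩).2]
      exact Submodule.smul_mem _ _ (Submodule.sum_mem _ fun i _ =>
        Submodule.smul_mem _ _ (Submodule.subset_span ⟨i, rfl⟩))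
    · have : ρ y = 0 := image_eq_zero_of_notMem_tsupport fun h => hyU (hρ h)
      simp [this]
  · simp [Z]

/-- A linear function of the coordinates, cut off by a bump function equal to `1` near `x`. It turns
the soldering condition on differentials into one on all covectors. -/
theorem exists_contMDiff_differential_eq (x : M) (β : V →L[ℝ] ℝ) :
    ∃ f : M → ℝ, ContMDiff 𝓘(ℝ, V) 𝓘(ℝ, ℝ) ∞ f ∧ differential V f x = β := by
  let ρ : SmoothBumpFunction 𝓘(ℝ, V) x := Classical.arbitrary _
  refine ⟨fun y => ρ y • β (extChartAt 𝓘(ℝ, V) x y), ρ.contMDiff_smul ?_, ?_⟩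
  · exact β.contDiff.contMDiff.comp_contMDiffOn contMDiffOn_extChartAt
  · refine differential_self_of_hasFDerivAt (β.hasFDerivAt.congr_of_eventuallyEq ?_)
    have h1 : ∀ᶠ z in 𝓝 (extChartAt 𝓘(ℝ, V) x x), ρ ((extChartAt 𝓘(ℝ, V) x).symm z) = 1 := by
      have h := (continuousAt_extChartAt_symm (I := 𝓘(ℝ, V)) x).tendsto
      rw [extChartAt_to_inv] at h
      exact h.eventually ρ.eventuallyEq_one
    filter_upwards [h1, extChartAt_target_mem_nhds (I := 𝓘(ℝ, V)) x] with z hz hzT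
    rw [Function.comp_apply, hz, one_smul, (extChartAt 𝓘(ℝ, V) x).right_inv hzT]

end Extensions

/-! ### Linear algebra of the lifted bivector. -/

section LinearAlgebra

variable {V : Type*} [NormedAddCommGroup V] [NormedSpace ℝ V] [FiniteDimensional ℝ V]

theorem mem_of_forall_continuousLinearMap {W : Submodule ℝ V} {y : V}
    (h : ∀ c : V →L[ℝ] ℝ, (∀ w ∈ W, c w = 0) → c y = 0) : y ∈ W := by
  by_contra hy
  obtain ⟨c, hc, hW⟩ := Submodule.exists_le_ker_of_notMem hy
  exact hc (h (LinearMap.toContinuousLinearMap c) fun w hw => hW hw)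

/-- The condition that a tangent lift `(q b, q a + q' b)` preserves the subspace
`{(t, D t + w) | t ∈ T, w ∈ W}`, in terms of `T` and `W`. -/
theorem lift_mem_iff (T W : Submodule ℝ V) (q q' : (V →L[ℝ] ℝ) →L[ℝ] V) (D : V →L[ℝ] V)
    (hq : ∀ b c : V →L[ℝ] ℝ, c (q b) = - b (q c)) :
    (∀ a b : V →L[ℝ] ℝ, (∀ t w : V, t ∈ T → w - D t ∈ W → a t + b w = 0) →
      q b ∈ T ∧ q a + q' b - D (q b) ∈ W) ↔
    (∀ b : V →L[ℝ] ℝ, (∀ w ∈ W, b w = 0) → q b ∈ T) ∧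
      ∀ b c : V →L[ℝ] ℝ, (∀ w ∈ W, b w = 0) → (∀ w ∈ W, c w = 0) →
        c (q' b) - c (q (b ∘L D)) - c (D (q b)) = 0 := by
  constructor
  · intro h
    -- If `b` kills `W`, then `(-(b ∘L D), b)` annihilates every `(t, w)` with `w - D t ∈ W`,
    -- whatever `t` is.
    have key (b : V →L[ℝ] ℝ) (hb : ∀ w ∈ W, b w = 0) :=
      h (-(b ∘L D)) b fun t w _ hw => by
        have := hb _ hw
        rw [map_sub] at this
        simp only [neg_apply, ContinuousLinearMap.comp_apply]
        linarith
    refine ⟨fun b hb => (key b hb).1, fun b c hb hc => ?_⟩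
    have := hc _ (key b hb).2
    simp only [map_sub, map_add, map_neg] at this
    linarith
  · rintro ⟨h1, h2⟩ a b hab
    have hb : ∀ w ∈ W, b w = 0 := fun w hw => by
      simpa using hab 0 w T.zero_mem (by simpa using hw)
    have hθ : ∀ t ∈ T, a t + b (D t) = 0 := fun t ht => hab t (D t) ht (by simp)
    refine ⟨h1 b hb, mem_of_forall_continuousLinearMap fun c hc => ?_⟩
    -- Since `q c ∈ T`, the functional `a + b ∘L D` kills it; by skew-symmetry `c (q a) = -c (q (b
    -- ∘L D))`, which reduces the goal to `e1`.
    have e1 := h2 b c hb hc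
    have e2 := hθ _ (h1 c hc)
    have e3 := hq a c
    have e4 := hq (b ∘L D) c
    simp only [ContinuousLinearMap.comp_apply] at e4
    simp only [map_sub, map_add]
    linarith

end LinearAlgebra

/-! ### Soldering as tangency of the complete lifts. -/

section Soldering

variable {V : Type*} [NormedAddCommGroup V] [NormedSpace ℝ V] [FiniteDimensional ℝ V]
  {M : Type*} [TopologicalSpace M] [ChartedSpace V M] [IsManifold 𝓘(ℝ, V) ∞ M]
  {N : Set M} {ν : SubspaceField V M} {n : ℕ}

/-- Matches the quantifier over points of `νN` with the quantifier over normal fields in the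
soldering conditions. -/
theorem forall_normalTotalSpace_iff [T2Space M] (hN : IsNormalizedSubmanifold n N ν)
    {p : TangentBundle 𝓘(ℝ, V) M → Prop} :
    (∀ v ∈ normalTotalSpace N ν, p v) ↔
      ∀ X : RoughVectorField V M, IsNormalField N ν X → ∀ x ∈ N, p ⟨x, X x⟩ := by
  refine ⟨fun h X hX x hx => h _ ⟨hx, hX.2 x hx⟩, fun h v hv => ?_⟩
  obtain ⟨X, hX, hXv⟩ := exists_isNormalField_eq hN hv.1 hv.2
  have := h X hX v.proj hv.1
  rwa [hXv] at this

theorem lieDeriv_eq_zero_iff [T2Space M] (Q : BivectorField V M) {X : RoughVectorField V M}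
    (hX : IsNormalField N ν X) (x : M) :
    (∀ f g : M → ℝ, ContMDiff 𝓘(ℝ, V) 𝓘(ℝ, ℝ) ∞ f → ContMDiff 𝓘(ℝ, V) 𝓘(ℝ, ℝ) ∞ g →
      differential V f x ∈ ann (ν x) → differential V g x ∈ ann (ν x) →
        Q.lieDeriv X f g x = 0) ↔
    ∀ b c : V →L[ℝ] ℝ, (∀ w : V, w ∈ ν x → b w = 0) → (∀ w : V, w ∈ ν x → c w = 0) →
      c (fderiv ℝ (tensorInChart Q.sharp x) (extChartAt 𝓘(ℝ, V) x x) (X x) b)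
      - c (tensorInChart Q.sharp x (extChartAt 𝓘(ℝ, V) x x)
          (b ∘L fderiv ℝ (vectorInChart X x) (extChartAt 𝓘(ℝ, V) x x)))
      - c (fderiv ℝ (vectorInChart X x) (extChartAt 𝓘(ℝ, V) x x)
          (tensorInChart Q.sharp x (extChartAt 𝓘(ℝ, V) x x) b)) = 0 := by
  constructor
  · intro h b c hb hc
    obtain ⟨f, hf, rfl⟩ := exists_contMDiff_differential_eq x b
    obtain ⟨g, hg, rfl⟩ := exists_contMDiff_differential_eq x c
    exact (lieDeriv_eq Q hX.1 hf hg rfl rfl).symm.trans (h f g hf hg hb hc)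
  · intro h f g hf hg hfν hgν
    exact (lieDeriv_eq Q hX.1 hf hg rfl rfl).trans (h _ _ hfν hgν)

theorem completeLiftTensor_mem_iff [T2Space M] (hN : IsNormalizedSubmanifold n N ν)
    (Q : BivectorField V M) {X : RoughVectorField V M} (hX : IsNormalField N ν X) {x : M}
    (hx : x ∈ N) :
    (∀ α ∈ ann (tangentSpaceOf 𝓘(ℝ, V).tangent (normalTotalSpace N ν) ⟨x, X x⟩),
      completeLiftTensor Q.sharp ⟨x, X x⟩ α ∈
        tangentSpaceOf 𝓘(ℝ, V).tangent (normalTotalSpace N ν) ⟨x, X x⟩) ↔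
    (∀ α ∈ ann (ν x), Q.sharp x α ∈ tangentSpaceOf 𝓘(ℝ, V) N x) ∧
      ∀ f g : M → ℝ, ContMDiff 𝓘(ℝ, V) 𝓘(ℝ, ℝ) ∞ f → ContMDiff 𝓘(ℝ, V) 𝓘(ℝ, ℝ) ∞ g →
        differential V f x ∈ ann (ν x) → differential V g x ∈ ann (ν x) →
          Q.lieDeriv X f g x = 0 := by
  set q := tensorInChart Q.sharp x (extChartAt 𝓘(ℝ, V) x x)
  set q' := fderiv ℝ (tensorInChart Q.sharp x) (extChartAt 𝓘(ℝ, V) x x) (X x)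
  set D := fderiv ℝ (vectorInChart X x) (extChartAt 𝓘(ℝ, V) x x)
  have hsharp (b : V →L[ℝ] ℝ) : q b = Q.sharp x b := tensorInChart_self Q.sharp x b
  have hskew (b c : V →L[ℝ] ℝ) : c (q b) = - b (q c) := by
    rw [hsharp, hsharp]
    exact Q.skew x b c
  have hmem := mem_tangentSpaceOf_normalTotalSpace_iff hN hX hx
  have hlift (a b : V →L[ℝ] ℝ) :
      completeLiftTensor Q.sharp ⟨x, X x⟩ (a.coprod b : V × V →L[ℝ] ℝ) =
        ((q b, q a + q' b) : V × V) := completeLiftTensor_eq Q.sharp ⟨x, X x⟩ a b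
  rw [lieDeriv_eq_zero_iff Q hX]
  let T : Submodule ℝ V := tangentSpaceOf 𝓘(ℝ, V) N x
  let W : Submodule ℝ V := ν x
  refine Iff.trans ?_ ((lift_mem_iff T W q q' D hskew).trans
    (and_congr (forall₂_congr fun b _ => by rw [hsharp]; rfl) Iff.rfl))
  constructor
  · intro h a b hab
    have := h (a.coprod b : V × V →L[ℝ] ℝ) fun p hp => by
      obtain ⟨ht, hw⟩ := (hmem p.1 p.2).1 hp
      exact hab p.1 p.2 ht hw
    rw [hlift] at this
    exact (hmem _ _).1 this
  · intro h α hα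
    let α' : V × V →L[ℝ] ℝ := α
    have hα' : α = ((α' ∘L .inl ℝ V V).coprod (α' ∘L .inr ℝ V V) : V × V →L[ℝ] ℝ) :=
      (ContinuousLinearMap.coprod_comp_inl_inr α').symm
    rw [hα', hlift]
    refine (hmem _ _).2 (h _ _ fun t w ht hw => ?_)
    have e : α' (t, w) = 0 := hα _ ((hmem t w).2 ⟨ht, hw⟩)
    simpa [← map_add] using e

theorem isSolderedBivector_iff [T2Space M] (hN : IsNormalizedSubmanifold n N ν)
    (Q : BivectorField V M) :
    IsSolderedBivector N ν Q ↔
      ∀ v ∈ normalTotalSpace N ν,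
        ∀ α ∈ ann (tangentSpaceOf 𝓘(ℝ, V).tangent (normalTotalSpace N ν) v),
          completeLiftTensor Q.sharp v α ∈
            tangentSpaceOf 𝓘(ℝ, V).tangent (normalTotalSpace N ν) v := by
  rw [forall_normalTotalSpace_iff hN]
  constructor
  · intro h X hX x hx
    exact (completeLiftTensor_mem_iff hN Q hX hx).2 ⟨h.algebraic x hx, h.lie X hX x hx⟩
  · intro h
    refine ⟨fun x hx => ?_, fun X hX x hx =>
      ((completeLiftTensor_mem_iff hN Q hX hx).1 (h X hX x hx)).2⟩
    -- The algebraic clause does not involve `X`, so any normal field will do.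
    obtain ⟨X, hX, -⟩ := exists_isNormalField_eq hN hx (ν x).zero_mem
    exact ((completeLiftTensor_mem_iff hN Q hX hx).1 (h X hX x hx)).1

/-- With `(a, b) = (Y, DY(X))`, the vector `b - D a` is exactly the coordinate form of `[X, Y]`; in
finite dimension its membership in `ν x` is detected by `ann (ν x)`. -/
theorem completeLiftVector_mem_iff (hN : IsNormalizedSubmanifold n N ν)
    (Y : RoughVectorField V M) {X : RoughVectorField V M} (hX : IsNormalField N ν X) {x : M}
    (hx : x ∈ N) :
    completeLiftVector Y ⟨x, X x⟩ ∈
        tangentSpaceOf 𝓘(ℝ, V).tangent (normalTotalSpace N ν) ⟨x, X x⟩ ↔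
      Y x ∈ tangentSpaceOf 𝓘(ℝ, V) N x ∧
        ∀ α ∈ ann (ν x), α (VectorField.mlieBracket 𝓘(ℝ, V) X Y x) = 0 := by
  rw [completeLiftVector_eq, mlieBracket_eq]
  refine (mem_tangentSpaceOf_normalTotalSpace_iff hN hX hx _ _).trans (and_congr Iff.rfl ?_)
  exact ⟨fun h α hα => hα _ h, fun h => mem_of_forall_continuousLinearMap h⟩

theorem isSolderedVector_iff [T2Space M] (hN : IsNormalizedSubmanifold n N ν)
    (Y : RoughVectorField V M) :
    IsSolderedVector N ν Y ↔
      ∀ v ∈ normalTotalSpace N ν, completeLiftVector Y v ∈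
        tangentSpaceOf 𝓘(ℝ, V).tangent (normalTotalSpace N ν) v := by
  rw [forall_normalTotalSpace_iff hN]
  constructor
  · intro h X hX x hx
    exact (completeLiftVector_mem_iff hN Y hX hx).2 ⟨h.algebraic x hx, h.lie X hX x hx⟩
  · intro h
    refine ⟨fun x hx => ?_, fun X hX x hx =>
      ((completeLiftVector_mem_iff hN Y hX hx).1 (h X hX x hx)).2⟩
    obtain ⟨X, hX, -⟩ := exists_isNormalField_eq hN hx (ν x).zero_mem
    exact ((completeLiftVector_mem_iff hN Y hX hx).1 (h X hX x hx)).1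

end Soldering

end DiracSub

end

theorem proposition3p4
    {V : Type*} [NormedAddCommGroup V] [NormedSpace ℝ V] [FiniteDimensional ℝ V]
    {M : Type*} [TopologicalSpace M] [T2Space M] [SecondCountableTopology M]
    [ChartedSpace V M] [IsManifold 𝓘(ℝ, V) ∞ M]
    (J : DiracSub.JacobiStructure V M) (n : ℕ) (N : Set M) (ν : DiracSub.SubspaceField V M)
    (hN : DiracSub.IsNormalizedSubmanifold n N ν) :
    (DiracSub.IsAlmostDirac J N ν ↔
      ∀ v ∈ DiracSub.normalTotalSpace N ν,
        ∀ α ∈ DiracSub.ann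
          (DiracSub.tangentSpaceOf 𝓘(ℝ, V).tangent (DiracSub.normalTotalSpace N ν) v),
          DiracSub.completeLiftTensor J.Λ.sharp v α ∈
            DiracSub.tangentSpaceOf 𝓘(ℝ, V).tangent (DiracSub.normalTotalSpace N ν) v) ∧
    (DiracSub.IsDirac J N ν ↔
      (∀ v ∈ DiracSub.normalTotalSpace N ν,
        ∀ α ∈ DiracSub.ann
          (DiracSub.tangentSpaceOf 𝓘(ℝ, V).tangent (DiracSub.normalTotalSpace N ν) v),
          DiracSub.completeLiftTensor J.Λ.sharp v α ∈
            DiracSub.tangentSpaceOf 𝓘(ℝ, V).tangent (DiracSub.normalTotalSpace N ν) v) ∧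
      ∀ v ∈ DiracSub.normalTotalSpace N ν,
        DiracSub.completeLiftVector J.E v ∈
          DiracSub.tangentSpaceOf 𝓘(ℝ, V).tangent (DiracSub.normalTotalSpace N ν) v) := by
  exact ⟨DiracSub.isSolderedBivector_iff hN J.Λ,
    and_congr (DiracSub.isSolderedBivector_iff hN J.Λ) (DiracSub.isSolderedVector_iff hN J.E)⟩
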